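/- Let $\mathfrak g$ be a finite-dimensional real semisimple Lie algebra with Killing form $B_{\mathfrak g}$ and a Cartan involution $\theta$ (an involutive automorphism such that $\langle x,y\rangle=-B_{\mathfrak g}(\theta x,y)$ is positive definite); give $\mathfrak g$ this inner product. Give $\mathbb R^n$ its standard inner product and standard basis $e_1,\dots,e_n$, and give $V=\Lambda^2(\mathbb R^n)^*\otimes\mathbb R^n\oplus\operatorname{Hom}(\mathbb R^n,\mathfrak g)$ the inner product with $$\|(\mu,\phi)\|^2=\|\mu\|^2+\|\phi\|^2,\qquad \|\mu\|^2=\sum_{i<j}|\mu(e_i,e_j)|^2=\tfrac12\sum_{i,j}|\mu(e_i,e_j)|^2,\qquad \|\phi\|^2=\sum_i|\phi(e_i)|^2 .$$ Let $\mathcal L_n(\mathfrak g)\subset\mathbb P(V)$ be the set of classes $(\mu:\phi)$ of non-zero pairs, where $\mu$ is a Lie bracket on $\mathbb R^n$ and $\phi:\mathfrak h_\mu=(\mathbb R^n,\mu)\to\mathfrak g$ is a homomorphism of Lie algebras. The energy of $(\mu:\phi)$ is $E(\mu:\phi)=\|m(\mu:\phi)\|^2$, where $$m(\mu:\phi)=\frac1{\|(\mu,\phi)\|^2}\bigl(M(\mu)-\phi^*\phi,\;u_{\mu,\phi}\bigr)\in\mathfrak{gl}(n,\mathbb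 R)\oplus\mathfrak g$$ is the moment map of the action of $GL(n,\mathbb R)\times\operatorname{Inn}(\mathfrak g)$ on $V$, with $$\langle M(\mu)X,Y\rangle=\tfrac12\sum_{i,j}\langle X,\mu(e_i,e_j)\rangle\langle\mu(e_i,e_j),Y\rangle-\sum_i\langle\mu(X,e_i),\mu(Y,e_i)\rangle,\qquad u_{\mu,\phi}=\sum_i[\theta\phi(e_i),\phi(e_i)],$$ and $\|(A,z)\|^2=\operatorname{Tr}(AA^{T})+\langle z,z\rangle$. **Proposition.** Let $(\mu:\phi)\in\mathcal L_n(\mathfrak g)$ be such that $\mathfrak h_\mu$ is a simple Lie algebra, and let $B_\mu$ be the Killing form of $\mathfrak h_\mu$. Then $E(\mu:\phi)=\frac1n$ if and only if there is a Cartan involution $\theta'$ of $\mathfrak h_\mu$ such that $$\theta\phi=\phi\theta'\qquad\text{and}\qquad \langle X,Y\rangle=-\frac{n}{2\|\mu\|^2}\,B_\mu(\theta'X,Y)\quad\text{for all }X,Y\in\mathbb R^n .$$ -/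

import Mathlib

open scoped LinearAlgebra.Projectivization

noncomputable section

namespace LiePairs

/-- `ℝⁿ` with its standard inner product. -/
abbrev Euc (n : ℕ) : Type := EuclideanSpace ℝ (Fin n)

/-- The standard orthonormal basis of `ℝⁿ`. -/
abbrev stdVec {n : ℕ} (i : Fin n) : Euc n := EuclideanSpace.single i (1 : ℝ)

/-- The space `Λ²(ℝⁿ)* ⊗ ℝⁿ` of alternating bilinear maps `ℝⁿ × ℝⁿ → ℝⁿ`. -/
def Skew (n : ℕ) : Submodule ℝ (Euc n →ₗ[ℝ] Euc n →ₗ[ℝ] Euc n) where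
  carrier := {μ | ∀ X, μ X X = 0}
  add_mem' := fun {μ ν} hμ hν X => by
    rw [LinearMap.add_apply, LinearMap.add_apply, hμ X, hν X, add_zero]
  zero_mem' := fun X => by simp
  smul_mem' := fun t μ hμ X => by
    rw [LinearMap.smul_apply, LinearMap.smul_apply, hμ X, smul_zero]

/-- A Lie bracket on `ℝⁿ`: an alternating bilinear map satisfying the Jacobi identity. -/
structure LieLaw (n : ℕ) where
  /-- the underlying alternating bilinear map -/
  toSkew : Skew n
  jacobi : ∀ X Y Z : Euc n,
    toSkew.1 X (toSkew.1 Y Z) = toSkew.1 (toSkew.1 X Y) Z + toSkew.1 Y (toSkew.1 X Z)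

/-- The Lie algebra `𝔥_μ = (ℝⁿ, μ)`; it keeps the standard inner product of `ℝⁿ`. -/
def LieLaw.Alg {n : ℕ} (_μ : LieLaw n) : Type := Euc n

section instances

variable {n : ℕ} (μ : LieLaw n)

instance : NormedAddCommGroup μ.Alg := inferInstanceAs (NormedAddCommGroup (Euc n))

instance : InnerProductSpace ℝ μ.Alg := inferInstanceAs (InnerProductSpace ℝ (Euc n))

instance : FiniteDimensional ℝ μ.Alg := inferInstanceAs (FiniteDimensional ℝ (Euc n))

instance : LieRing μ.Alg where
  bracket X Y := (show Euc n from μ.toSkew.1 X Y)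
  add_lie X Y Z := by
    exact congrArg (fun f : Euc n →ₗ[ℝ] Euc n => f Z) (map_add μ.toSkew.1 X Y)
  lie_add X Y Z := map_add (μ.toSkew.1 X) Y Z
  lie_self X := μ.toSkew.2 X
  leibniz_lie X Y Z := μ.jacobi X Y Z

instance : LieAlgebra ℝ μ.Alg where
  lie_smul t X Y := map_smul (μ.toSkew.1 X) t Y

end instances

/-- A Cartan involution of a real Lie algebra: an involutive automorphism `θ` for which the
symmetric form `(x, y) ↦ -B(θ x, y)`, with `B` the Killing form, is positive definite. -/
structure IsCartanInvolution {L : Type*} [LieRing L] [LieAlgebra ℝ L] (θ : L ≃ₗ⁅ℝ⁆ L) : Prop where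
  involutive : ∀ x, θ (θ x) = x
  posDef : ∀ x, x ≠ 0 → 0 < -killingForm ℝ L (θ x) x

variable {n : ℕ} {𝔤 : Type*} [LieRing 𝔤] [LieAlgebra ℝ 𝔤]

/-- The form `⟨x, y⟩ = -B(θ x, y)` on `𝔤`, an inner product when `θ` is a Cartan involution. -/
def gInner (θ : 𝔤 ≃ₗ⁅ℝ⁆ 𝔤) (x y : 𝔤) : ℝ := -killingForm ℝ 𝔤 (θ x) y

/-- The vector space `V = Λ²(ℝⁿ)* ⊗ ℝⁿ ⊕ Hom(ℝⁿ, 𝔤)`. -/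
abbrev PairSpace (n : ℕ) (𝔤 : Type*) [LieRing 𝔤] [LieAlgebra ℝ 𝔤] : Type _ :=
  Skew n × (Euc n →ₗ[ℝ] 𝔤)

/-- The inner product of two elements of `Λ²(ℝⁿ)* ⊗ ℝⁿ`, that is,
`∑_{i<j} ⟨μ(eᵢ, eⱼ), ν(eᵢ, eⱼ)⟩ = ½ ∑_{i,j} ⟨μ(eᵢ, eⱼ), ν(eᵢ, eⱼ)⟩`. -/
def skewInner (μ ν : Skew n) : ℝ :=
  (1 / 2) * ∑ i : Fin n, ∑ j : Fin n,
    inner ℝ (μ.1 (stdVec i) (stdVec j)) (ν.1 (stdVec i) (stdVec j))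

/-- The inner product of `V` induced by those of `ℝⁿ` and `𝔤`. -/
def pairInner (θ : 𝔤 ≃ₗ⁅ℝ⁆ 𝔤) (v w : PairSpace n 𝔤) : ℝ :=
  skewInner v.1 w.1 + ∑ i : Fin n, gInner θ (v.2 (stdVec i)) (w.2 (stdVec i))

/-- The infinitesimal action of `δ ∈ 𝔤𝔩(n, ℝ)` on `Λ²(ℝⁿ)* ⊗ ℝⁿ`:
`(δ · μ)(X, Y) = δ μ(X, Y) - μ(δ X, Y) - μ(X, δ Y)`. -/
def skewAct (δ : Euc n →ₗ[ℝ] Euc n) (μ : Skew n) : Skew n :=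
  ⟨μ.1.compr₂ δ - μ.1.comp δ - μ.1.compl₂ δ, fun X => by
    have h := μ.2 (δ X + X)
    have h1 := μ.2 (δ X)
    have h2 := μ.2 X
    simp only [map_add, LinearMap.add_apply, h1, h2, zero_add, add_zero] at h
    simp only [LinearMap.sub_apply, LinearMap.compr₂_apply, LinearMap.comp_apply,
      LinearMap.compl₂_apply, h2, map_zero, zero_sub]
    rw [← neg_add', add_comm, h, neg_zero]⟩

/-- The infinitesimal action of `𝔤𝔩(n, ℝ) ⊕ 𝔤` on `V` that comes from the action
`(g, f) · (μ, φ) = (g μ(g⁻¹ ·, g⁻¹ ·), f φ g⁻¹)` of `GL(n, ℝ) × Inn(𝔤)`. -/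
def pairAct (δ : Euc n →ₗ[ℝ] Euc n) (z : 𝔤) (v : PairSpace n 𝔤) : PairSpace n 𝔤 :=
  (skewAct δ v.1, (LieAlgebra.ad ℝ 𝔤 z).comp v.2 - v.2.comp δ)

/-- The matrix of `M(μ)`:
`⟨M(μ) X, Y⟩ = ½ ∑_{i,j} ⟨X, μ(eᵢ, eⱼ)⟩ ⟨μ(eᵢ, eⱼ), Y⟩ - ∑ᵢ ⟨μ(X, eᵢ), μ(Y, eᵢ)⟩`. -/
def skewMoment (μ : Skew n) : Matrix (Fin n) (Fin n) ℝ := Matrix.of fun k l =>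
  (1 / 2) * (∑ i : Fin n, ∑ j : Fin n,
    μ.1 (stdVec i) (stdVec j) k * μ.1 (stdVec i) (stdVec j) l)
  - ∑ i : Fin n, inner ℝ (μ.1 (stdVec k) (stdVec i)) (μ.1 (stdVec l) (stdVec i))

/-- The matrix of `φ* φ`: its `(k, l)` entry is `⟨φ eₖ, φ eₗ⟩`. -/
def gram (θ : 𝔤 ≃ₗ⁅ℝ⁆ 𝔤) (φ : Euc n →ₗ[ℝ] 𝔤) : Matrix (Fin n) (Fin n) ℝ := Matrix.of fun k l =>
  gInner θ (φ (stdVec k)) (φ (stdVec l))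

/-- The vector `u_φ = ∑ᵢ [θ φ eᵢ, φ eᵢ]` of `𝔤`. -/
def uVec (θ : 𝔤 ≃ₗ⁅ℝ⁆ 𝔤) (φ : Euc n →ₗ[ℝ] 𝔤) : 𝔤 :=
  ∑ i : Fin n, ⁅θ (φ (stdVec i)), φ (stdVec i)⁆

/-- The moment map `m = ‖(μ, φ)‖⁻² (M(μ) - φ* φ, u_φ)`, with values in `𝔤𝔩(n, ℝ) ⊕ 𝔤`. -/
def momentMap (θ : 𝔤 ≃ₗ⁅ℝ⁆ 𝔤) (v : PairSpace n 𝔤) : Matrix (Fin n) (Fin n) ℝ × 𝔤 :=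
  (pairInner θ v v)⁻¹ • (skewMoment v.1 - gram θ v.2, uVec θ v.2)

/-- The squared norm `Tr(A Aᵀ) + ⟨z, z⟩` of an element `(A, z)` of `𝔤𝔩(n, ℝ) ⊕ 𝔤`. -/
def momentNormSq (θ : 𝔤 ≃ₗ⁅ℝ⁆ 𝔤) (a : Matrix (Fin n) (Fin n) ℝ × 𝔤) : ℝ :=
  (a.1 * a.1.transpose).trace + gInner θ a.2 a.2

section characterization

lemma gInner_comm (θ : 𝔤 ≃ₗ⁅ℝ⁆ 𝔤) (hθ : IsCartanInvolution θ) (x y : 𝔤) :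
    gInner θ x y = gInner θ y x := by
  unfold gInner
  rw [← LieAlgebra.killingForm_of_equiv_apply θ (θ x) y, hθ.involutive, LieModule.traceForm_comm]

lemma gInner_ad (θ : 𝔤 ≃ₗ⁅ℝ⁆ 𝔤) (hθ : IsCartanInvolution θ) (z y : 𝔤) :
    gInner θ ⁅z, y⁆ y = gInner θ ⁅θ y, y⁆ z := by
  unfold gInner
  rw [LieEquiv.map_lie, LieEquiv.map_lie, hθ.involutive, LieModule.traceForm_apply_lie_apply,
    LieModule.traceForm_comm, ← LieAlgebra.killingForm_of_equiv_apply θ ⁅y, θ y⁆ z,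
    LieEquiv.map_lie, hθ.involutive]

lemma expand (w : Euc n) : w = ∑ k : Fin n, w k • stdVec k := by
  ext j
  simp [Pi.single_apply]

lemma skewMoment_spec (μ : Skew n) (δ : Euc n →ₗ[ℝ] Euc n) :
    ∑ k : Fin n, ∑ l : Fin n, skewMoment μ k l * δ (stdVec l) k = skewInner (skewAct δ μ) μ := by
  have hδ : ∑ i : Fin n, ∑ j : Fin n, inner ℝ (δ (μ.1 (stdVec i) (stdVec j)))
      (μ.1 (stdVec i) (stdVec j)) = ∑ k : Fin n, ∑ l : Fin n, (∑ i : Fin n, ∑ j : Fin n,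
        μ.1 (stdVec i) (stdVec j) k * μ.1 (stdVec i) (stdVec j) l) * δ (stdVec l) k := by
    have h : ∀ w : Euc n, inner ℝ (δ w) w
        = ∑ k : Fin n, ∑ l : Fin n, w k * w l * δ (stdVec l) k := fun w => by
      have hw : δ w = ∑ l : Fin n, w l • δ (stdVec l) := by
        conv_lhs => rw [expand w]
        simp [map_sum]
      rw [PiLp.inner_apply]
      refine Finset.sum_congr rfl fun k _ => ?_
      rw [hw]
      simp only [WithLp.ofLp_sum, Finset.sum_apply, WithLp.ofLp_smul, Pi.smul_apply, smul_eq_mul,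
        RCLike.inner_apply, RCLike.conj_to_real, Finset.mul_sum]
      exact Finset.sum_congr rfl fun l _ => by ring
    simp only [h, Finset.sum_mul]
    rw [Finset.sum_congr rfl fun i _ => Finset.sum_comm, Finset.sum_comm]
    refine Finset.sum_congr rfl fun k _ => ?_
    rw [Finset.sum_congr rfl fun i _ => Finset.sum_comm, Finset.sum_comm]
  have h1 : ∑ i : Fin n, ∑ j : Fin n, inner ℝ (μ.1 (δ (stdVec i)) (stdVec j))
      (μ.1 (stdVec i) (stdVec j)) = ∑ k : Fin n, ∑ l : Fin n, (∑ i : Fin n,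
        inner ℝ (μ.1 (stdVec k) (stdVec i)) (μ.1 (stdVec l) (stdVec i))) * δ (stdVec l) k := by
    rw [Finset.sum_comm (γ := Fin n) (f := fun k l => (∑ i : Fin n,
        inner ℝ (μ.1 (stdVec k) (stdVec i)) (μ.1 (stdVec l) (stdVec i))) * δ (stdVec l) k)]
    refine Finset.sum_congr rfl fun i _ => ?_
    simp only [Finset.sum_mul]
    rw [Finset.sum_comm]
    refine Finset.sum_congr rfl fun j _ => ?_
    conv_lhs => rw [expand (δ (stdVec i))]
    simp only [map_sum, map_smul, LinearMap.sum_apply, LinearMap.smul_apply, sum_inner,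
      inner_smul_left, RCLike.conj_to_real]
    exact Finset.sum_congr rfl fun k _ => by ring
  have h2 : ∑ i : Fin n, ∑ j : Fin n, inner ℝ (μ.1 (stdVec i) (δ (stdVec j)))
      (μ.1 (stdVec i) (stdVec j)) = ∑ i : Fin n, ∑ j : Fin n,
        inner ℝ (μ.1 (δ (stdVec i)) (stdVec j)) (μ.1 (stdVec i) (stdVec j)) := by
    have hsk : ∀ X Y : Euc n, μ.1 X Y = -μ.1 Y X := fun X Y => by
      have h := μ.2 (X + Y)
      have hX := μ.2 X
      have hY := μ.2 Y
      simp only [map_add, LinearMap.add_apply, hX, hY, zero_add, add_zero] at h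
      exact eq_neg_of_add_eq_zero_right h
    rw [Finset.sum_comm]
    refine Finset.sum_congr rfl fun i _ => Finset.sum_congr rfl fun j _ => ?_
    rw [hsk (stdVec j) (δ (stdVec i)), hsk (stdVec j) (stdVec i), inner_neg_neg]
  simp only [skewInner, skewAct, LinearMap.sub_apply, LinearMap.compr₂_apply, LinearMap.comp_apply,
    LinearMap.compl₂_apply, inner_sub_left, Finset.sum_sub_distrib, hδ, h2, h1]
  simp only [skewMoment, Matrix.of_apply, sub_mul, Finset.sum_sub_distrib, mul_assoc,
    ← Finset.mul_sum]
  ring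

lemma gram_spec (θ : 𝔤 ≃ₗ⁅ℝ⁆ 𝔤) (φ : Euc n →ₗ[ℝ] 𝔤) (δ : Euc n →ₗ[ℝ] Euc n) :
    ∑ k : Fin n, ∑ l : Fin n, gram θ φ k l * δ (stdVec l) k
      = ∑ i : Fin n, gInner θ (φ (δ (stdVec i))) (φ (stdVec i)) := by
  rw [Finset.sum_comm]
  refine Finset.sum_congr rfl fun i _ => ?_
  conv_rhs => rw [expand (δ (stdVec i))]
  simp only [gInner, gram, map_sum, map_smul, LinearMap.sum_apply, LinearMap.smul_apply,
    smul_eq_mul, Matrix.of_apply, ← Finset.sum_neg_distrib]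
  exact Finset.sum_congr rfl fun k _ => by ring

/-- The defining property of the moment map: `⟨m(v), (δ, z)⟩ = ⟨(δ, z) · v, v⟩ / ‖v‖²` for all
`(δ, z)` in `𝔤𝔩(n, ℝ) ⊕ 𝔤`. -/
theorem momentMap_spec (θ : 𝔤 ≃ₗ⁅ℝ⁆ 𝔤) (hθ : IsCartanInvolution θ) (v : PairSpace n 𝔤)
    (δ : Euc n →ₗ[ℝ] Euc n) (z : 𝔤) :
    (∑ k : Fin n, ∑ l : Fin n, (momentMap θ v).1 k l * δ (stdVec l) k)
      + gInner θ (momentMap θ v).2 z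
      = pairInner θ (pairAct δ z v) v / pairInner θ v v := by
  have h1 : gInner θ (uVec θ v.2) z
      = ∑ i : Fin n, gInner θ ⁅z, v.2 (stdVec i)⁆ (v.2 (stdVec i)) := by
    simp only [gInner_ad θ hθ, uVec]
    simp only [gInner, map_sum, LinearMap.sum_apply, Finset.sum_neg_distrib]
  have h2 : pairInner θ (pairAct δ z v) v
      = (∑ k : Fin n, ∑ l : Fin n, (skewMoment v.1 - gram θ v.2) k l * δ (stdVec l) k)
        + gInner θ (uVec θ v.2) z := by
    simp only [Matrix.sub_apply, sub_mul, Finset.sum_sub_distrib, skewMoment_spec, gram_spec, h1,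
      pairInner, pairAct]
    have h3 : ∀ i : Fin n, gInner θ (((LieAlgebra.ad ℝ 𝔤 z).comp v.2 - v.2.comp δ) (stdVec i))
        (v.2 (stdVec i)) = gInner θ ⁅z, v.2 (stdVec i)⁆ (v.2 (stdVec i))
          - gInner θ (v.2 (δ (stdVec i))) (v.2 (stdVec i)) := fun i => by
      simp only [gInner, LinearMap.sub_apply, LinearMap.comp_apply, LieAlgebra.ad_apply, map_sub]
      ring
    simp only [h3, Finset.sum_sub_distrib]
    ring
  rw [h2, div_eq_inv_mul, mul_add, Finset.mul_sum]
  simp only [Finset.mul_sum, momentMap, Prod.smul_fst, Prod.smul_snd, Matrix.smul_apply,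
    smul_eq_mul, mul_assoc]
  congr 1
  simp only [gInner, map_smul, LinearMap.smul_apply, smul_eq_mul, mul_neg]

end characterization

lemma momentMap_smul (θ : 𝔤 ≃ₗ⁅ℝ⁆ 𝔤) (t : ℝ) (ht : t ≠ 0) (v : PairSpace n 𝔤) :
    momentMap θ (t • v) = momentMap θ v := by
  have hs : skewInner (t • v.1) (t • v.1) = t ^ 2 * skewInner v.1 v.1 := by
    simp only [skewInner, Submodule.coe_smul, LinearMap.smul_apply, inner_smul_left,
      inner_smul_right, RCLike.conj_to_real, Finset.mul_sum]
    exact Finset.sum_congr rfl fun i _ => Finset.sum_congr rfl fun j _ => by ring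
  have hg : ∀ x y : 𝔤, gInner θ (t • x) (t • y) = t ^ 2 * gInner θ x y := fun x y => by
    simp only [gInner, map_smul, LinearMap.smul_apply, smul_eq_mul]
    ring
  have hp : pairInner θ (t • v) (t • v) = t ^ 2 * pairInner θ v v := by
    simp only [pairInner, Prod.smul_fst, Prod.smul_snd, LinearMap.smul_apply, hs, hg, mul_add,
      Finset.mul_sum]
  have hm : skewMoment (t • v.1) - gram θ (t • v.2) = t ^ 2 • (skewMoment v.1 - gram θ v.2) := by
    ext k l
    simp only [skewMoment, gram, Matrix.sub_apply, Matrix.of_apply, Matrix.smul_apply,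
      Submodule.coe_smul, LinearMap.smul_apply, hg, inner_smul_left, inner_smul_right,
      RCLike.conj_to_real, PiLp.smul_apply, smul_eq_mul, mul_sub, Finset.mul_sum]
    congr 1
    congr 1
    · exact Finset.sum_congr rfl fun i _ => Finset.sum_congr rfl fun j _ => by ring
    · exact Finset.sum_congr rfl fun i _ => by ring
  have hu : uVec θ (t • v.2) = t ^ 2 • uVec θ v.2 := by
    simp only [uVec, LinearMap.smul_apply, map_smul, smul_lie, lie_smul, smul_smul,
      Finset.smul_sum, pow_two]
  simp only [momentMap, Prod.smul_fst, Prod.smul_snd, hp, hm, hu, ← Prod.smul_mk, smul_smul]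
  congr 1
  rw [mul_inv, mul_right_comm, inv_mul_cancel₀ (pow_ne_zero 2 ht), one_mul]

/-- The energy `E = ‖m‖²` on the projective space of `V`. -/
def energy (θ : 𝔤 ≃ₗ⁅ℝ⁆ 𝔤) (p : ℙ ℝ (PairSpace n 𝔤)) : ℝ :=
  Projectivization.lift (fun v : {v : PairSpace n 𝔤 // v ≠ 0} => momentNormSq θ (momentMap θ v.1))
    (by
      rintro ⟨a, ha⟩ ⟨b, hb⟩ t h
      have h' : a = t • b := h
      have ht : t ≠ 0 := by
        rintro rfl
        exact ha (by rw [h', zero_smul])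
      change momentNormSq θ (momentMap θ a) = momentNormSq θ (momentMap θ b)
      rw [h', momentMap_smul θ t ht b]) p

/-- A pair `(μ, φ) ∈ L_n(𝔤)`, with `φ : 𝔥_μ → 𝔤` a Lie algebra homomorphism, as a vector of `V`. -/
def pairVec (μ : LieLaw n) (φ : μ.Alg →ₗ⁅ℝ⁆ 𝔤) : PairSpace n 𝔤 :=
  (μ.toSkew, (φ : μ.Alg →ₗ[ℝ] 𝔤))

end LiePairs

end

namespace LiePairs

/-! The `𝔤𝔩(n)`-component of the moment map always has trace `-1`. Splitting off its scalar part, `E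
= 1/n + ‖m₁ + 1/n‖² + ‖m₂‖²`, so `E = 1/n` means exactly `m = (-1/n, 0)`
(`momentNormSq_momentMap_eq_iff`).

Suppose `m = (-1/n, 0)` and let `ξ = (δ, z)` annihilate `v = (μ, φ)`. The transpose of `ξ` is `ξᵀ =
(δᵀ, -θ z)`, and `‖ξᵀ v‖² = ⟨[ξ, ξᵀ] v, v⟩ = ‖v‖² ⟨m, [ξ, ξᵀ]⟩`. This is a multiple of the trace of
a commutator, hence zero (`pairAct_adjoint_eq_zero`). The pairs `(ad X, φ X)` annihilate `v`, so
each `(ad X)ᵀ` is a derivation, hence inner, and `ad (θ' X) = -(ad X)ᵀ` defines an involution `θ'`.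
The form `-B_μ(θ' X, Y) = tr((ad X)ᵀ ad Y)` is positive definite and, by a Schur argument
(`exists_eq_mul_inner`), proportional to the inner product. The `𝔤`-component of the same
annihilation gives `θ φ = φ θ'` (`apply_comm_of_lie_eq`).

Conversely, the metric condition makes `-ad (θ' X)` the transpose of `ad X`. Schur then makes `φ* φ`
scalar, and also the two sums in `M(μ)`; the vector `u` vanishes by antisymmetry, and the trace
fixes the scalar. -/

variable {n : ℕ} {𝔤 : Type*} [LieRing 𝔤] [LieAlgebra ℝ 𝔤]

/-! ### Sums over an orthonormal basis -/

section Euclidean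

lemma sum_apply_adjoint (f : Euc n →ₗ[ℝ] Euc n →ₗ[ℝ] ℝ) (δ : Euc n →ₗ[ℝ] Euc n) :
    ∑ i : Fin n, f (δ (stdVec i)) (stdVec i)
      = ∑ i : Fin n, f (stdVec i) (LinearMap.adjoint δ (stdVec i)) := by
  have h : ∀ i k : Fin n, LinearMap.adjoint δ (stdVec k) i = δ (stdVec i) k := fun i k => by
    have := LinearMap.adjoint_inner_right δ (stdVec i) (stdVec k)
    simpa [stdVec, EuclideanSpace.inner_single_left, EuclideanSpace.inner_single_right] using this
  have h1 : ∀ i, f (δ (stdVec i)) (stdVec i)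
      = ∑ k, δ (stdVec i) k * f (stdVec k) (stdVec i) := fun i => by
    conv_lhs => rw [expand (δ (stdVec i))]
    simp only [map_sum, map_smul, LinearMap.sum_apply, LinearMap.smul_apply, smul_eq_mul]
  have h2 : ∀ k, f (stdVec k) (LinearMap.adjoint δ (stdVec k))
      = ∑ i, δ (stdVec i) k * f (stdVec k) (stdVec i) := fun k => by
    conv_lhs => rw [expand (LinearMap.adjoint δ (stdVec k))]
    simp only [map_sum, map_smul, smul_eq_mul, h]
  simp only [h1, h2]
  exact Finset.sum_comm

lemma inner_eq_sum_mul (x y : Euc n) :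
    inner ℝ x y = ∑ i : Fin n, inner ℝ x (stdVec i) * inner ℝ (stdVec i) y := by
  simpa [EuclideanSpace.basisFun_apply] using
    ((EuclideanSpace.basisFun (Fin n) ℝ).sum_inner_mul_inner x y).symm

lemma trace_eq_sum (δ : Euc n →ₗ[ℝ] Euc n) :
    LinearMap.trace ℝ (Euc n) δ = ∑ i : Fin n, inner ℝ (stdVec i) (δ (stdVec i)) := by
  simpa [EuclideanSpace.basisFun_apply] using
    LinearMap.trace_eq_sum_inner δ (EuclideanSpace.basisFun (Fin n) ℝ)

/-- Pythagoras: `-1/n` times the identity is the orthogonal projection of `P` to the scalar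
matrices, and its squared norm is `1/n`. -/
lemma sum_sq_apply_add {P : Matrix (Fin n) (Fin n) ℝ} (hP : P.trace = -1) (hn : (n : ℝ) ≠ 0) :
    ∑ k : Fin n, ∑ l : Fin n, ((P + (1 / (n : ℝ)) • (1 : Matrix (Fin n) (Fin n) ℝ)) k l) ^ 2
      = (P * P.transpose).trace - 1 / (n : ℝ) := by
  have h : ∀ k l : Fin n, ((P + (1 / (n : ℝ)) • (1 : Matrix (Fin n) (Fin n) ℝ)) k l) ^ 2
      = P k l * P k l + (2 / n) * (if k = l then P k l else 0)
        + (1 / (n : ℝ)) ^ 2 * (if k = l then 1 else 0) := fun k l => by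
    simp only [Matrix.add_apply, Matrix.smul_apply, Matrix.one_apply, smul_eq_mul]
    split_ifs <;> ring
  simp only [h, Finset.sum_add_distrib, ← Finset.mul_sum, Finset.sum_ite_eq, Finset.mem_univ,
    if_true]
  have h1 : ∑ k : Fin n, P k k = -1 := hP
  have h2 : ∑ k : Fin n, ∑ l : Fin n, P k l * P k l = (P * P.transpose).trace := by
    simp [Matrix.trace, Matrix.mul_apply]
  rw [h1, h2]
  simp only [Finset.sum_const, Finset.card_univ, Fintype.card_fin, nsmul_eq_mul]
  field_simp
  ring

end Euclidean

/-! ### The representation on pairs and its transposition -/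

section Representation

lemma Skew.swap (μ : Skew n) (X Y : Euc n) : μ.1 X Y = -μ.1 Y X := by
  have h := μ.2 (X + Y)
  simp only [map_add, LinearMap.add_apply, μ.2 X, μ.2 Y, zero_add, add_zero] at h
  exact eq_neg_of_add_eq_zero_right h

lemma skewAct_apply (δ : Euc n →ₗ[ℝ] Euc n) (μ : Skew n) (X Y : Euc n) :
    (skewAct δ μ).1 X Y = δ (μ.1 X Y) - μ.1 (δ X) Y - μ.1 X (δ Y) := rfl

lemma skewInner_skewAct (δ : Euc n →ₗ[ℝ] Euc n) (μ ν : Skew n) :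
    skewInner (skewAct δ μ) ν = skewInner μ (skewAct (LinearMap.adjoint δ) ν) := by
  have h1 : ∀ μ ν : Skew n, ∑ i : Fin n, ∑ j : Fin n,
      inner ℝ (μ.1 (δ (stdVec i)) (stdVec j)) (ν.1 (stdVec i) (stdVec j))
        = ∑ i : Fin n, ∑ j : Fin n, inner ℝ (μ.1 (stdVec i) (stdVec j))
          (ν.1 (LinearMap.adjoint δ (stdVec i)) (stdVec j)) := fun μ ν => by
    rw [Finset.sum_comm]
    conv_rhs => rw [Finset.sum_comm]
    refine Finset.sum_congr rfl fun j _ => ?_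
    simpa using sum_apply_adjoint
      ((innerₗ (Euc n)).compl₁₂ (μ.1.flip (stdVec j)) (ν.1.flip (stdVec j))) δ
  have h2 : ∑ i : Fin n, ∑ j : Fin n,
      inner ℝ (μ.1 (stdVec i) (δ (stdVec j))) (ν.1 (stdVec i) (stdVec j))
        = ∑ i : Fin n, ∑ j : Fin n, inner ℝ (μ.1 (stdVec i) (stdVec j))
          (ν.1 (stdVec i) (LinearMap.adjoint δ (stdVec j))) := by
    refine Finset.sum_congr rfl fun i _ => ?_
    simpa using sum_apply_adjoint
      ((innerₗ (Euc n)).compl₁₂ (μ.1 (stdVec i)) (ν.1 (stdVec i))) δ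
  simp only [skewInner, skewAct_apply, inner_sub_left, inner_sub_right, Finset.sum_sub_distrib,
    h1, h2, LinearMap.adjoint_inner_right]

/-- The bilinear form `⟨x, y⟩ = -B(θ x, y)` as a linear map. -/
noncomputable def gForm (θ : 𝔤 ≃ₗ⁅ℝ⁆ 𝔤) : 𝔤 →ₗ[ℝ] 𝔤 →ₗ[ℝ] ℝ :=
  -(killingForm ℝ 𝔤) ∘ₗ ((θ : 𝔤 →ₗ⁅ℝ⁆ 𝔤) : 𝔤 →ₗ[ℝ] 𝔤)

lemma gForm_apply (θ : 𝔤 ≃ₗ⁅ℝ⁆ 𝔤) (x y : 𝔤) : gForm θ x y = gInner θ x y := rfl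

/-- Invariance of the Killing form: the transpose of `ad z` is `-ad (θ z)`. -/
lemma gInner_lie (θ : 𝔤 ≃ₗ⁅ℝ⁆ 𝔤) (z x y : 𝔤) :
    gInner θ ⁅z, x⁆ y = gInner θ x ⁅-θ z, y⁆ := by
  unfold gInner
  rw [LieEquiv.map_lie, neg_lie, map_neg, ← lie_skew, map_neg, LinearMap.neg_apply,
    LieModule.traceForm_apply_lie_apply]

lemma gInner_self_nonneg {θ : 𝔤 ≃ₗ⁅ℝ⁆ 𝔤} (hθ : IsCartanInvolution θ) (x : 𝔤) :
    0 ≤ gInner θ x x := by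
  by_cases hx : x = 0
  · simp [hx, gInner]
  · exact (hθ.posDef x hx).le

lemma gInner_self_eq_zero {θ : 𝔤 ≃ₗ⁅ℝ⁆ 𝔤} (hθ : IsCartanInvolution θ) {x : 𝔤} :
    gInner θ x x = 0 ↔ x = 0 := by
  refine ⟨fun h => ?_, fun h => by simp [h, gInner]⟩
  by_contra hx
  exact (hθ.posDef x hx).ne' h

lemma skewInner_self_nonneg (μ : Skew n) : 0 ≤ skewInner μ μ :=
  mul_nonneg (by norm_num) (Finset.sum_nonneg fun _ _ => Finset.sum_nonneg fun _ _ =>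
    real_inner_self_nonneg)

lemma ext_stdVec {V : Type*} [AddCommGroup V] [Module ℝ V] {f g : Euc n →ₗ[ℝ] V}
    (h : ∀ i, f (stdVec i) = g (stdVec i)) : f = g := by
  ext x
  rw [expand x]
  simp only [map_sum, map_smul, h]

lemma skewInner_self_eq_zero {μ : Skew n} (h : skewInner μ μ = 0) : μ = 0 := by
  have h' : ∑ i : Fin n, ∑ j : Fin n,
      inner ℝ (μ.1 (stdVec i) (stdVec j)) (μ.1 (stdVec i) (stdVec j)) = 0 := by
    unfold skewInner at h
    linarith
  rw [Finset.sum_eq_zero_iff_of_nonneg fun _ _ => Finset.sum_nonneg fun _ _ =>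
    real_inner_self_nonneg] at h'
  refine Subtype.ext (ext_stdVec fun i => ext_stdVec fun j => ?_)
  have hi := h' i (Finset.mem_univ i)
  rw [Finset.sum_eq_zero_iff_of_nonneg fun _ _ => real_inner_self_nonneg] at hi
  simpa using hi j (Finset.mem_univ j)

lemma pairInner_self_eq_zero {θ : 𝔤 ≃ₗ⁅ℝ⁆ 𝔤} (hθ : IsCartanInvolution θ) {v : PairSpace n 𝔤}
    (h : pairInner θ v v = 0) : v = 0 := by
  have h2 : 0 ≤ ∑ i : Fin n, gInner θ (v.2 (stdVec i)) (v.2 (stdVec i)) :=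
    Finset.sum_nonneg fun _ _ => gInner_self_nonneg hθ _
  have h1 := skewInner_self_nonneg v.1
  unfold pairInner at h
  refine Prod.ext (skewInner_self_eq_zero (by linarith)) (ext_stdVec fun i => ?_)
  have h3 : ∑ i : Fin n, gInner θ (v.2 (stdVec i)) (v.2 (stdVec i)) = 0 := by linarith
  rw [Finset.sum_eq_zero_iff_of_nonneg fun _ _ => gInner_self_nonneg hθ _] at h3
  exact (gInner_self_eq_zero hθ).1 (h3 i (Finset.mem_univ i))

/-- The representation is compatible with transposition, where the transpose of `(δ, z)` is `(δᵀ, -θ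
z)`. -/
lemma pairInner_pairAct (θ : 𝔤 ≃ₗ⁅ℝ⁆ 𝔤) (δ : Euc n →ₗ[ℝ] Euc n)
    (z : 𝔤) (v w : PairSpace n 𝔤) :
    pairInner θ (pairAct δ z v) w
      = pairInner θ v (pairAct (LinearMap.adjoint δ) (-θ z) w) := by
  have h1 : ∑ i : Fin n, gInner θ (v.2 (δ (stdVec i))) (w.2 (stdVec i))
      = ∑ i : Fin n, gInner θ (v.2 (stdVec i)) (w.2 (LinearMap.adjoint δ (stdVec i))) :=
    sum_apply_adjoint ((gForm θ).compl₁₂ v.2 w.2) δ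
  have hl : ∀ x y z : 𝔤, gInner θ (x - y) z = gInner θ x z - gInner θ y z := fun x y z => by
    simp only [← gForm_apply, map_sub, LinearMap.sub_apply]
  have hr : ∀ x y z : 𝔤, gInner θ x (y - z) = gInner θ x y - gInner θ x z := fun x y z => by
    simp only [← gForm_apply, map_sub]
  simp only [pairInner, pairAct, skewInner_skewAct, LinearMap.sub_apply, LinearMap.comp_apply,
    LieAlgebra.ad_apply, hl, hr, Finset.sum_sub_distrib, h1, gInner_lie θ]

lemma pairAct_zero_right (δ : Euc n →ₗ[ℝ] Euc n) (z : 𝔤) : pairAct δ z (0 : PairSpace n 𝔤) = 0 := by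
  refine Prod.ext (Subtype.ext ?_) ?_
  · refine LinearMap.ext fun X => LinearMap.ext fun Y => ?_
    simp [pairAct, skewAct]
  · refine LinearMap.ext fun X => ?_
    simp [pairAct]

lemma pairAct_lie (δ ε : Euc n →ₗ[ℝ] Euc n) (z w : 𝔤) (v : PairSpace n 𝔤) :
    pairAct (δ ∘ₗ ε - ε ∘ₗ δ) ⁅z, w⁆ v
      = pairAct δ z (pairAct ε w v) - pairAct ε w (pairAct δ z v) := by
  refine Prod.ext (Subtype.ext ?_) ?_
  · refine LinearMap.ext fun X => LinearMap.ext fun Y => ?_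
    simp only [pairAct, Prod.fst_sub, Submodule.coe_sub, LinearMap.sub_apply, skewAct_apply,
      LinearMap.comp_apply, map_sub]
    abel
  · refine LinearMap.ext fun X => ?_
    simp only [pairAct, Prod.snd_sub, LinearMap.sub_apply, LinearMap.comp_apply,
      LieAlgebra.ad_apply, map_sub, lie_lie]
    abel

end Representation

/-! ### Pairs of minimal energy -/

section MomentMap

lemma trace_skewMoment (μ : Skew n) : (skewMoment μ).trace = -skewInner μ μ := by
  have h : ∑ k : Fin n, ∑ i : Fin n, ∑ j : Fin n,
      μ.1 (stdVec i) (stdVec j) k * μ.1 (stdVec i) (stdVec j) k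
        = ∑ i : Fin n, ∑ j : Fin n,
          inner ℝ (μ.1 (stdVec i) (stdVec j)) (μ.1 (stdVec i) (stdVec j)) := by
    simp only [PiLp.inner_apply, RCLike.inner_apply, RCLike.conj_to_real]
    rw [Finset.sum_comm]
    exact Finset.sum_congr rfl fun i _ => Finset.sum_comm
  simp only [Matrix.trace, Matrix.diag_apply, skewMoment, Matrix.of_apply, Finset.sum_sub_distrib,
    ← Finset.mul_sum, h, skewInner]
  ring

lemma trace_momentMap {θ : 𝔤 ≃ₗ⁅ℝ⁆ 𝔤} (hθ : IsCartanInvolution θ) {v : PairSpace n 𝔤}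
    (hv : v ≠ 0) : (momentMap θ v).1.trace = -1 := by
  have h0 : pairInner θ v v ≠ 0 := fun h => hv (pairInner_self_eq_zero hθ h)
  have h : (skewMoment v.1 - gram θ v.2).trace = -pairInner θ v v := by
    rw [Matrix.trace_sub, trace_skewMoment]
    simp only [Matrix.trace, Matrix.diag_apply, gram, Matrix.of_apply, pairInner]
    ring
  rw [momentMap, Prod.smul_fst, Matrix.trace_smul, h, smul_eq_mul, mul_neg, inv_mul_cancel₀ h0]

/-- The energy is minimal exactly at the pairs whose moment map is a multiple of `(1, 0)`. -/
lemma momentNormSq_momentMap_eq_iff {θ : 𝔤 ≃ₗ⁅ℝ⁆ 𝔤} (hθ : IsCartanInvolution θ)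
    {v : PairSpace n 𝔤} (hv : v ≠ 0) (hn : (n : ℝ) ≠ 0) :
    momentNormSq θ (momentMap θ v) = 1 / (n : ℝ) ↔
      (momentMap θ v).1 = -(1 / (n : ℝ)) • (1 : Matrix (Fin n) (Fin n) ℝ) ∧
        (momentMap θ v).2 = 0 := by
  have h := sum_sq_apply_add (trace_momentMap hθ hv) hn
  have hnn : ∀ k ∈ Finset.univ, 0 ≤ ∑ l : Fin n,
      (((momentMap θ v).1 + (1 / (n : ℝ)) • (1 : Matrix (Fin n) (Fin n) ℝ)) k l) ^ 2 :=
    fun k _ => Finset.sum_nonneg fun l _ => sq_nonneg _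
  have hs := Finset.sum_nonneg hnn
  have hg := gInner_self_nonneg hθ (momentMap θ v).2
  rw [momentNormSq]
  constructor
  · intro hE
    refine ⟨?_, (gInner_self_eq_zero hθ).1 (by linarith)⟩
    have h0 := (Finset.sum_eq_zero_iff_of_nonneg hnn).1 (by linarith)
    rw [neg_smul, eq_neg_iff_add_eq_zero]
    ext k l
    have hk := h0 k (Finset.mem_univ k)
    rw [Finset.sum_eq_zero_iff_of_nonneg fun l _ => sq_nonneg _] at hk
    simpa using hk l (Finset.mem_univ l)
  · rintro ⟨h1, h2⟩
    rw [h2, (gInner_self_eq_zero hθ).2 rfl]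
    rw [neg_smul, eq_neg_iff_add_eq_zero] at h1
    rw [h1] at h
    simp at h
    simp
    linarith

/-- The stabilizer of a pair of minimal energy is invariant under transposition. -/
lemma pairAct_adjoint_eq_zero {θ : 𝔤 ≃ₗ⁅ℝ⁆ 𝔤} (hθ : IsCartanInvolution θ) {v : PairSpace n 𝔤}
    (hv : v ≠ 0) {r : ℝ} (h1 : (momentMap θ v).1 = r • (1 : Matrix (Fin n) (Fin n) ℝ))
    (h2 : (momentMap θ v).2 = 0) {δ : Euc n →ₗ[ℝ] Euc n} {z : 𝔤} (h : pairAct δ z v = 0) :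
    pairAct (LinearMap.adjoint δ) (-θ z) v = 0 := by
  have h0 : pairInner θ v v ≠ 0 := fun h => hv (pairInner_self_eq_zero hθ h)
  set ε := LinearMap.adjoint δ with hε
  -- Scalar matrices are orthogonal to commutators, which have trace zero.
  have htr : ∑ k : Fin n, (δ ∘ₗ ε - ε ∘ₗ δ) (stdVec k) k = 0 := by
    have := trace_eq_sum (δ ∘ₗ ε - ε ∘ₗ δ)
    rw [map_sub, LinearMap.trace_comp_comm', sub_self] at this
    simpa [stdVec, EuclideanSpace.inner_single_left] using this.symm
  have hspec := momentMap_spec θ hθ v (δ ∘ₗ ε - ε ∘ₗ δ) ⁅z, -θ z⁆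
  have hz : gInner θ 0 ⁅z, -θ z⁆ = 0 := by simp [gInner]
  rw [h1, h2, hz] at hspec
  simp only [Matrix.smul_apply, Matrix.one_apply, smul_eq_mul, mul_ite, mul_one, mul_zero, ite_mul,
    zero_mul, Finset.sum_ite_eq, Finset.mem_univ, if_true, ← Finset.mul_sum, htr, add_zero] at hspec
  -- As `ξ v = 0`, only `⟨ξ ξᵀ v, v⟩ = ‖ξᵀ v‖²` is left of the commutator term.
  rw [eq_comm, div_eq_zero_iff, or_iff_left h0, pairAct_lie, h, pairAct_zero_right,
    show pairAct δ z (pairAct ε (-θ z) v) - 0 = pairAct δ z (pairAct ε (-θ z) v) by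
      refine Prod.ext ?_ ?_
      · refine Subtype.ext (LinearMap.ext fun X => LinearMap.ext fun Y => ?_)
        exact sub_zero ((pairAct δ z (pairAct ε (-θ z) v)).1.1 X Y)
      · exact LinearMap.ext fun X => sub_zero ((pairAct δ z (pairAct ε (-θ z) v)).2 X),
    pairInner_pairAct θ] at hspec
  exact pairInner_self_eq_zero hθ hspec

end MomentMap

variable {μ : LieLaw n}

/-! ### Simple Lie algebras and Schur's lemma -/

section Simple

lemma LieLaw.exists_bracket_ne_zero (hs : LieAlgebra.IsSimple ℝ μ.Alg) :
    ∃ X Y : Euc n, μ.toSkew.1 X Y ≠ 0 := by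
  by_contra! h
  exact hs.non_abelian ⟨fun X Y => h X Y⟩

lemma LieLaw.nontrivial (hs : LieAlgebra.IsSimple ℝ μ.Alg) : Nontrivial (Euc n) := by
  obtain ⟨X, Y, h⟩ := LieLaw.exists_bracket_ne_zero hs
  exact ⟨_, _, h⟩

lemma LieLaw.isKilling (hs : LieAlgebra.IsSimple ℝ μ.Alg) : LieAlgebra.IsKilling ℝ μ.Alg := by
  infer_instance

lemma LieLaw.injective (hs : LieAlgebra.IsSimple ℝ μ.Alg) {X Y : Euc n}
    (h : μ.toSkew.1 X = μ.toSkew.1 Y) : X = Y := by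
  have hk := LieLaw.isKilling hs
  have h0 : ∀ Z : Euc n, μ.toSkew.1 (X - Y) Z = 0 := fun Z => by
    rw [map_sub, h, sub_self, LinearMap.zero_apply]
  have h1 : LieDerivation.ad ℝ μ.Alg (show μ.Alg from X - Y) = 0 :=
    LieDerivation.ext fun Z => (LieDerivation.ad_apply_apply ℝ μ.Alg _ Z).trans (h0 Z)
  exact sub_eq_zero.1 ((LieDerivation.IsKilling.ad_apply_eq_zero_iff ℝ μ.Alg _).1 h1)

/-- A symmetric form on a simple Lie algebra that is invariant with respect to the transposition
of the inner product is a multiple of the inner product. -/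
lemma exists_eq_mul_inner (hs : LieAlgebra.IsSimple ℝ μ.Alg) (β : Euc n →ₗ[ℝ] Euc n →ₗ[ℝ] ℝ)
    (hsymm : ∀ X Y, β X Y = β Y X)
    (hinv : ∀ Z X Y, β (μ.toSkew.1 Z X) Y = β X (LinearMap.adjoint (μ.toSkew.1 Z) Y)) :
    ∃ r : ℝ, ∀ X Y, β X Y = r * inner ℝ X Y := by
  have := LieLaw.nontrivial hs
  -- `G` represents `β` through the inner product; invariance of `β` means that `G` commutes with
  -- every `ad Z`.
  let G : Euc n →ₗ[ℝ] Euc n := ∑ i : Fin n, (β.flip (stdVec i)).smulRight (stdVec i)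
  have hG : ∀ X Y, inner ℝ (G X) Y = β X Y := fun X Y => by
    have hY : β X Y = ∑ i : Fin n, Y i * β X (stdVec i) := by
      conv_lhs => rw [expand Y]
      simp only [map_sum, map_smul, smul_eq_mul]
    rw [hY]
    simp only [G, LinearMap.sum_apply, LinearMap.smulRight_apply, LinearMap.flip_apply, sum_inner,
      inner_smul_left, EuclideanSpace.inner_single_left, stdVec]
    simp [mul_comm]
  have hGs : G.IsSymmetric := fun X Y => by
    rw [hG, hsymm, ← hG, real_inner_comm]
  have hGc : ∀ Z X, G (μ.toSkew.1 Z X) = μ.toSkew.1 Z (G X) := fun Z X => by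
    refine ext_inner_right ℝ fun Y => ?_
    rw [hG, hinv, ← hG, LinearMap.adjoint_inner_right]
  -- Symmetry of `G` provides a real eigenvalue. Its eigenspace is a non-zero ideal, hence
  -- everything.
  obtain ⟨r, hr⟩ : ∃ r : ℝ, Module.End.HasEigenvalue G r :=
    ⟨_, hGs.hasEigenvalue_iSup_of_finiteDimensional⟩
  have hlie : ∀ Z X : Euc n, G X = r • X → G (μ.toSkew.1 Z X) = r • μ.toSkew.1 Z X :=
    fun Z X hX => by rw [hGc, hX, map_smul]
  obtain ⟨X₀, hX₀⟩ := hr.exists_hasEigenvector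
  let I : LieIdeal ℝ μ.Alg :=
    { carrier := {X | G X = r • (show Euc n from X)}
      add_mem' := fun {X Y} hX hY => by
        change G ((show Euc n from X) + (show Euc n from Y)) = _
        rw [map_add]
        exact (congrArg₂ (· + ·) hX hY).trans (smul_add r _ _).symm
      zero_mem' := (map_zero G).trans (smul_zero r).symm
      smul_mem' := fun t X hX => by
        change G (t • (show Euc n from X)) = _
        rw [map_smul]
        exact (congrArg (t • ·) hX).trans (smul_comm t r _)
      lie_mem := fun {Z X} hX => hlie Z X hX }
  have hI : I = ⊤ := (hs.eq_bot_or_eq_top I).resolve_left fun h => hX₀.2 (by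
    have hm : (show μ.Alg from X₀) ∈ I := hX₀.apply_eq_smul
    rw [h] at hm
    exact hm)
  refine ⟨r, fun X Y => ?_⟩
  have hX : (show μ.Alg from X) ∈ I := by rw [hI]; trivial
  rw [← hG, show G X = r • X from hX, inner_smul_left, RCLike.conj_to_real]

end Simple

/-! ### Cartan involutions from transposition -/

section Cartan

lemma killingForm_alg (X Y : μ.Alg) : killingForm ℝ μ.Alg X Y
    = LinearMap.trace ℝ (Euc n) (μ.toSkew.1 X ∘ₗ μ.toSkew.1 Y) := rfl

/-- `θ'` realizes the transposition of the inner product on the adjoint representation. -/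
def IsAdjointInvolution (θ' : μ.Alg ≃ₗ⁅ℝ⁆ μ.Alg) : Prop :=
  ∀ X : Euc n, μ.toSkew.1 (show Euc n from θ' X) = -LinearMap.adjoint (μ.toSkew.1 X)

lemma IsAdjointInvolution.gInner_eq_sum {θ' : μ.Alg ≃ₗ⁅ℝ⁆ μ.Alg} (h : IsAdjointInvolution θ')
    (X Y : Euc n) : gInner (𝔤 := μ.Alg) θ' X Y
      = ∑ i : Fin n, inner ℝ (μ.toSkew.1 X (stdVec i)) (μ.toSkew.1 Y (stdVec i)) := by
  refine (congrArg Neg.neg (killingForm_alg (θ' X) (show μ.Alg from Y))).trans ?_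
  rw [h X, LinearMap.neg_comp, map_neg, neg_neg, trace_eq_sum]
  simp only [LinearMap.comp_apply, LinearMap.adjoint_inner_right]

/-- Transposing twice is the identity, and the form is the Hilbert–Schmidt product of `ad X` and `ad
Y`; `ad` is injective. -/
lemma IsAdjointInvolution.isCartanInvolution (hs : LieAlgebra.IsSimple ℝ μ.Alg)
    {θ' : μ.Alg ≃ₗ⁅ℝ⁆ μ.Alg} (h : IsAdjointInvolution θ') : IsCartanInvolution θ' where
  involutive X := LieLaw.injective hs (by
    have h1 := h (θ' X)
    rw [h X, map_neg, LinearMap.adjoint_adjoint, neg_neg] at h1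
    exact h1)
  posDef X hX := by
    have h1 := h.gInner_eq_sum X X
    have h2 : ∀ i ∈ Finset.univ, 0 ≤ inner ℝ (μ.toSkew.1 X (stdVec i)) (μ.toSkew.1 X (stdVec i)) :=
      fun i _ => real_inner_self_nonneg
    refine lt_of_le_of_ne ((Finset.sum_nonneg h2).trans_eq h1.symm) fun h0 => hX ?_
    have h3 := (Finset.sum_eq_zero_iff_of_nonneg h2).1 (h1.symm.trans h0.symm)
    refine LieLaw.injective hs (ext_stdVec fun i => ?_)
    have h4 := inner_self_eq_zero.1 (h3 i (Finset.mem_univ i))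
    rw [h4]
    exact (congrArg (fun f : Euc n →ₗ[ℝ] Euc n => f (stdVec i)) (map_zero μ.toSkew.1)).symm

lemma IsAdjointInvolution.exists_gInner_eq (hs : LieAlgebra.IsSimple ℝ μ.Alg)
    {θ' : μ.Alg ≃ₗ⁅ℝ⁆ μ.Alg} (h : IsAdjointInvolution θ') :
    ∃ r : ℝ, ∀ X Y : Euc n, gInner (𝔤 := μ.Alg) θ' X Y = r * inner ℝ X Y := by
  let β : Euc n →ₗ[ℝ] Euc n →ₗ[ℝ] ℝ := ∑ i : Fin n,
    (innerₗ (Euc n)).compl₁₂ (μ.toSkew.1.flip (stdVec i)) (μ.toSkew.1.flip (stdVec i))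
  have hβ : ∀ X Y : Euc n, β X Y = gInner (𝔤 := μ.Alg) θ' X Y := fun X Y => by
    rw [h.gInner_eq_sum]
    simp [β]
  obtain ⟨r, hr⟩ := exists_eq_mul_inner hs β
    (fun X Y => by rw [hβ, hβ]; exact gInner_comm θ' (h.isCartanInvolution hs) X Y)
    (fun Z X Y => by
      rw [hβ, hβ, show LinearMap.adjoint (μ.toSkew.1 Z) = -μ.toSkew.1 (θ' Z) by
        rw [h Z, neg_neg]]
      exact (gInner_lie θ' (show μ.Alg from Z) X Y).trans
        (congrArg (gInner (𝔤 := μ.Alg) θ' X) (neg_lie (θ' Z) (show μ.Alg from Y))))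
  exact ⟨r, fun X Y => by rw [← hβ, hr]⟩

lemma IsAdjointInvolution.inner_eq (hs : LieAlgebra.IsSimple ℝ μ.Alg)
    {θ' : μ.Alg ≃ₗ⁅ℝ⁆ μ.Alg} (h : IsAdjointInvolution θ') (X Y : Euc n) :
    inner ℝ X Y = (n : ℝ) / (2 * skewInner μ.toSkew μ.toSkew) * gInner (𝔤 := μ.Alg) θ' X Y := by
  obtain ⟨r, hr⟩ := h.exists_gInner_eq hs
  have hμ : skewInner μ.toSkew μ.toSkew ≠ 0 := fun h0 => by
    obtain ⟨X, Y, hXY⟩ := LieLaw.exists_bracket_ne_zero hs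
    exact hXY (by rw [skewInner_self_eq_zero h0]; rfl)
  -- Summing the proportionality over the standard basis determines the constant.
  have hsum : 2 * skewInner μ.toSkew μ.toSkew = r * n := by
    have h1 : ∀ i : Fin n, gInner (𝔤 := μ.Alg) θ' (stdVec i) (stdVec i) = r := fun i => by
      rw [hr]
      simp [stdVec]
    simp only [h.gInner_eq_sum] at h1
    simp only [skewInner, h1, Finset.sum_const, Finset.card_univ, Fintype.card_fin, nsmul_eq_mul]
    ring
  rw [hr, hsum]
  have hrn : r * n ≠ 0 := hsum ▸ mul_ne_zero two_ne_zero hμ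
  have hr0 := left_ne_zero_of_mul hrn
  have hn0 := right_ne_zero_of_mul hrn
  field_simp

/-- If the inner derivations are closed under transposition, then transposition is induced by an
automorphism. -/
lemma exists_isAdjointInvolution (hs : LieAlgebra.IsSimple ℝ μ.Alg)
    (h : ∀ X : Euc n, ∃ W : Euc n, μ.toSkew.1 W = -LinearMap.adjoint (μ.toSkew.1 X)) :
    ∃ θ' : μ.Alg ≃ₗ⁅ℝ⁆ μ.Alg, IsAdjointInvolution θ' := by
  -- Each algebraic property of `t` is read off from `X ↦ -(ad X)ᵀ`, because `ad` is injective.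
  choose t ht using h
  have htt : ∀ X, t (t X) = X := fun X => LieLaw.injective hs (by
    rw [ht, ht, map_neg, LinearMap.adjoint_adjoint, neg_neg])
  have hlie : ∀ X Y, μ.toSkew.1 (μ.toSkew.1 X Y)
      = μ.toSkew.1 X ∘ₗ μ.toSkew.1 Y - μ.toSkew.1 Y ∘ₗ μ.toSkew.1 X := fun X Y => by
    refine LinearMap.ext fun Z => ?_
    simp only [LinearMap.sub_apply, LinearMap.comp_apply]
    rw [μ.jacobi X Y Z, add_sub_cancel_right]
  have hadd : ∀ X Y : Euc n, t (X + Y) = t X + t Y := fun X Y => LieLaw.injective hs (by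
    rw [ht, map_add, map_add, map_add, ht, ht, neg_add])
  have hsmul : ∀ (c : ℝ) (X : Euc n), t (c • X) = c • t X := fun c X => LieLaw.injective hs (by
    rw [ht, map_smul, map_smulₛₗ, map_smul, ht, smul_neg]
    rfl)
  have hbr : ∀ X Y : Euc n, t (μ.toSkew.1 X Y) = μ.toSkew.1 (t X) (t Y) := fun X Y =>
    LieLaw.injective hs (by
      rw [ht, hlie, hlie, ht, ht, map_sub, LinearMap.adjoint_comp, LinearMap.adjoint_comp]
      simp only [LinearMap.neg_comp, LinearMap.comp_neg, neg_neg, neg_sub])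
  exact ⟨
    { toFun := fun X => t X
      invFun := fun X => t X
      left_inv := htt
      right_inv := htt
      map_add' := hadd
      map_smul' := hsmul
      map_lie' := fun {X Y} => hbr X Y }, ht⟩

end Cartan

/-! ### From minimal energy to the Cartan involution -/

section Forward

/-- The first component is the Jacobi identity, the second says that `φ` is a homomorphism. -/
lemma pairAct_pairVec (φ : μ.Alg →ₗ⁅ℝ⁆ 𝔤) (X : μ.Alg) :
    pairAct (μ.toSkew.1 X) (φ X) (pairVec μ φ) = 0 := by
  refine Prod.ext (Subtype.ext ?_) ?_
  · refine LinearMap.ext fun Y => LinearMap.ext fun Z => ?_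
    change μ.toSkew.1 X (μ.toSkew.1 Y Z) - μ.toSkew.1 (μ.toSkew.1 X Y) Z
      - μ.toSkew.1 Y (μ.toSkew.1 X Z) = 0
    exact sub_eq_zero.2 (sub_eq_of_eq_add' (μ.jacobi X Y Z))
  · refine LinearMap.ext fun Y => ?_
    change ⁅φ X, φ Y⁆ - φ ⁅X, (show μ.Alg from Y)⁆ = 0
    rw [LieHom.map_lie, sub_self]

/-- Annihilating `μ` means being a derivation, and derivations are inner when the Killing form is
nondegenerate. -/
lemma exists_inner_of_pairAct_eq_zero (hs : LieAlgebra.IsSimple ℝ μ.Alg) {φ : μ.Alg →ₗ⁅ℝ⁆ 𝔤}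
    {δ : Euc n →ₗ[ℝ] Euc n} {z : 𝔤} (h : pairAct δ z (pairVec μ φ) = 0) :
    ∃ W : Euc n, μ.toSkew.1 W = δ := by
  have hk := LieLaw.isKilling hs
  have hδ : ∀ X Y : Euc n, δ (μ.toSkew.1 X Y) = μ.toSkew.1 X (δ Y) - μ.toSkew.1 Y (δ X) :=
    fun X Y => by
      have h1 : (skewAct δ μ.toSkew).1 X Y = 0 :=
        congrArg (fun w : PairSpace n 𝔤 => w.1.1 X Y) h
      rw [skewAct_apply, Skew.swap _ (δ X)] at h1
      rw [eq_comm, ← sub_eq_zero, ← neg_eq_zero, ← h1]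
      abel
  let D : LieDerivation ℝ μ.Alg μ.Alg :=
    { toFun := fun X => δ X
      map_add' := fun X Y => map_add δ X Y
      map_smul' := fun c X => map_smul δ c X
      leibniz' := fun X Y => hδ X Y }
  obtain ⟨W, hW⟩ := LieDerivation.IsKilling.exists_eq_ad D
  exact ⟨W, LinearMap.ext fun Y => (LieDerivation.ad_apply_apply ℝ μ.Alg W Y).symm.trans
    (congrArg (fun d : LieDerivation ℝ μ.Alg μ.Alg => d Y) hW)⟩

/-- If `θ φ(X)` and `φ(θ' X)` act alike on the image of `φ` for all `X`, then `θ φ = φ θ'`. -/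
lemma apply_comm_of_lie_eq (hs : LieAlgebra.IsSimple ℝ μ.Alg) {θ : 𝔤 ≃ₗ⁅ℝ⁆ 𝔤}
    (hθ : IsCartanInvolution θ) {θ' : μ.Alg ≃ₗ⁅ℝ⁆ μ.Alg} (hθ' : ∀ X, θ' (θ' X) = X)
    {φ : μ.Alg →ₗ⁅ℝ⁆ 𝔤} (h : ∀ X Y, ⁅θ (φ X), φ Y⁆ = φ ⁅θ' X, Y⁆) (X : μ.Alg) :
    θ (φ X) = φ (θ' X) := by
  -- The defect `T X = θ φ X - φ θ' X` centralizes the image of `φ`.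
  have hc : ∀ X Y, ⁅θ (φ X) - φ (θ' X), φ Y⁆ = 0 := fun X Y => by
    rw [sub_lie, h, LieHom.map_lie, sub_self]
  have hθT : ∀ X, θ (θ (φ X) - φ (θ' X)) = -(θ (φ (θ' X)) - φ (θ' (θ' X))) := fun X => by
    rw [map_sub, hθ.involutive, hθ', neg_sub]
  -- Perfectness upgrades this to Killing-orthogonality: `B(T X, [φ A, φ B]) = B([T X, φ A], φ B) =
  -- 0`.
  have hperf : ⁅(⊤ : LieIdeal ℝ μ.Alg), (⊤ : LieIdeal ℝ μ.Alg)⁆ = ⊤ :=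
    (hs.eq_bot_or_eq_top _).resolve_left fun h0 => hs.non_abelian ⟨fun A B => by
      have hAB : ⁅A, B⁆ ∈ ⁅(⊤ : LieIdeal ℝ μ.Alg), (⊤ : LieIdeal ℝ μ.Alg)⁆ :=
        LieSubmodule.lie_mem_lie trivial trivial
      rw [h0] at hAB
      exact hAB⟩
  have horth : ∀ X Y, killingForm ℝ 𝔤 (θ (φ X) - φ (θ' X)) (φ Y) = 0 := fun X Y => by
    have hY : Y ∈ (⊤ : LieIdeal ℝ μ.Alg) := trivial
    rw [← hperf, ← LieSubmodule.mem_toSubmodule,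
      LieSubmodule.lieIdeal_oper_eq_linear_span'] at hY
    induction hY using Submodule.span_induction with
    | mem Y hY =>
      obtain ⟨A, -, B, -, rfl⟩ := hY
      rw [LieHom.map_lie, ← LieModule.traceForm_apply_lie_apply, hc, map_zero,
        LinearMap.zero_apply]
    | zero => rw [map_zero, map_zero]
    | add A B _ _ hA hB => rw [map_add, map_add, hA, hB, add_zero]
    | smul c A _ hA => rw [map_smul, map_smul, hA, smul_zero]
  have horth' : ∀ X Y, killingForm ℝ 𝔤 (θ (φ X) - φ (θ' X)) (θ (φ Y)) = 0 := fun X Y => by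
    rw [← LieAlgebra.killingForm_of_equiv_apply θ, hθ.involutive, hθT, map_neg,
      LinearMap.neg_apply, horth, neg_zero]
  -- As `θ (T X) = -T (θ' X)`, the squared norm of `T X` is `B(T (θ' X), θ φ X - φ θ' X)`, where
  -- both terms vanish.
  have hT : gInner θ (θ (φ X) - φ (θ' X)) (θ (φ X) - φ (θ' X)) = 0 := by
    rw [gInner, hθT, map_neg, LinearMap.neg_apply, neg_neg, map_sub, horth, horth', sub_zero]
  exact sub_eq_zero.1 ((gInner_self_eq_zero hθ).1 hT)

end Forward

/-! ### From the Cartan involution to minimal energy -/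

section Backward

lemma isAdjointInvolution_of_inner_eq {θ' : μ.Alg ≃ₗ⁅ℝ⁆ μ.Alg} {c : ℝ}
    (h : ∀ X Y : Euc n, inner ℝ X Y = c * gInner (𝔤 := μ.Alg) θ' X Y) :
    IsAdjointInvolution θ' := fun X => by
  have h1 : ∀ Y Z : Euc n, inner ℝ (μ.toSkew.1 X Y) Z = inner ℝ Y ((-μ.toSkew.1 (θ' X)) Z) :=
    fun Y Z => (h _ _).trans ((congrArg (c * ·) ((gInner_lie θ' (show μ.Alg from X) Y Z).trans
      (congrArg (gInner (𝔤 := μ.Alg) θ' Y) (neg_lie (θ' X) (show μ.Alg from Z))))).trans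
        (h _ _).symm)
  have h2 : -μ.toSkew.1 (θ' X) = LinearMap.adjoint (μ.toSkew.1 X) := by
    rw [LinearMap.eq_adjoint_iff]
    intro Z Y
    rw [real_inner_comm, ← h1, real_inner_comm]
  rw [← h2, neg_neg]

lemma gInner_apply_left {θ : 𝔤 ≃ₗ⁅ℝ⁆ 𝔤} (hθ : IsCartanInvolution θ) (x y : 𝔤) :
    gInner θ (θ x) y = gInner θ x (θ y) := by
  rw [gInner, gInner, hθ.involutive, LieAlgebra.killingForm_of_equiv_apply]

/-- An involution of `𝔥_μ`, as an endomorphism of `ℝⁿ`. -/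
def toEnd (θ' : μ.Alg ≃ₗ⁅ℝ⁆ μ.Alg) : Euc n →ₗ[ℝ] Euc n :=
  ((θ' : μ.Alg →ₗ⁅ℝ⁆ μ.Alg) : μ.Alg →ₗ[ℝ] μ.Alg)

lemma toEnd_toEnd {θ' : μ.Alg ≃ₗ⁅ℝ⁆ μ.Alg} (hθ' : IsCartanInvolution θ') (X : Euc n) :
    toEnd θ' (toEnd θ' X) = X := hθ'.involutive X

lemma adjoint_toEnd {θ' : μ.Alg ≃ₗ⁅ℝ⁆ μ.Alg} (hθ' : IsCartanInvolution θ') {c : ℝ}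
    (h : ∀ X Y : Euc n, inner ℝ X Y = c * gInner (𝔤 := μ.Alg) θ' X Y) :
    LinearMap.adjoint (toEnd θ') = toEnd θ' := by
  rw [eq_comm, LinearMap.eq_adjoint_iff]
  exact fun X Y => (h _ _).trans ((congrArg (c * ·) (gInner_apply_left hθ' _ _)).trans (h _ _).symm)

/-- Each of the two sums in `M(μ)` is `r` times the inner product; with their coefficients, `r/2 - r
= -r/2`. -/
lemma skewMoment_eq_smul_one {θ' : μ.Alg ≃ₗ⁅ℝ⁆ μ.Alg} (hθ' : IsCartanInvolution θ')
    (h : IsAdjointInvolution θ') (hT : LinearMap.adjoint (toEnd θ') = toEnd θ') {r : ℝ}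
    (hr : ∀ X Y : Euc n, gInner (𝔤 := μ.Alg) θ' X Y = r * inner ℝ X Y) :
    skewMoment μ.toSkew = (-(r / 2)) • (1 : Matrix (Fin n) (Fin n) ℝ) := by
  have hsum : ∀ X Y : Euc n, ∑ i : Fin n,
      inner ℝ (μ.toSkew.1 X (stdVec i)) (μ.toSkew.1 Y (stdVec i)) = r * inner ℝ X Y :=
    fun X Y => by rw [← h.gInner_eq_sum, hr]
  have hadj : ∀ X Y Z : Euc n,
      inner ℝ X (μ.toSkew.1 Y Z) = inner ℝ (μ.toSkew.1 X (toEnd θ' Y)) Z := fun X Y Z => by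
    have h1 : LinearMap.adjoint (μ.toSkew.1 Y) = -μ.toSkew.1 (toEnd θ' Y) :=
      (neg_eq_iff_eq_neg.2 (h Y)).symm
    rw [← LinearMap.adjoint_inner_left, h1, Skew.swap μ.toSkew X, LinearMap.neg_apply]
  have hcoord : ∀ (k : Fin n) (Y Z : Euc n),
      μ.toSkew.1 Y Z k = inner ℝ (μ.toSkew.1 (stdVec k) (toEnd θ' Y)) Z := fun k Y Z => by
    rw [← hadj]
    simp [stdVec, EuclideanSpace.inner_single_left]
  have hfirst : ∀ k l : Fin n, ∑ i : Fin n, ∑ j : Fin n,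
      μ.toSkew.1 (stdVec i) (stdVec j) k * μ.toSkew.1 (stdVec i) (stdVec j) l
        = r * inner ℝ (stdVec k) (stdVec l) := fun k l => by
    -- Parseval in `j`, after moving `ad eᵢ` to the other side of the inner product.
    have h1 : ∀ i : Fin n, ∑ j : Fin n,
        μ.toSkew.1 (stdVec i) (stdVec j) k * μ.toSkew.1 (stdVec i) (stdVec j) l
          = inner ℝ (μ.toSkew.1 (stdVec k) (toEnd θ' (stdVec i)))
            (μ.toSkew.1 (stdVec l) (toEnd θ' (stdVec i))) := fun i => by
      rw [inner_eq_sum_mul]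
      refine Finset.sum_congr rfl fun j _ => ?_
      rw [hcoord, hcoord, real_inner_comm (stdVec j) (μ.toSkew.1 (stdVec l) _)]
    -- The self-adjoint involution `θ'` is orthogonal, so `θ' eᵢ` may be replaced by `eᵢ` in the
    -- sum.
    have h2 := sum_apply_adjoint ((innerₗ (Euc n)).compl₁₂ (μ.toSkew.1 (stdVec k))
      (μ.toSkew.1 (stdVec l) ∘ₗ toEnd θ')) (toEnd θ')
    simp only [LinearMap.compl₁₂_apply, LinearMap.comp_apply, hT, toEnd_toEnd hθ',
      innerₗ_apply_apply] at h2
    simp only [h1]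
    rw [h2, hsum]
  ext k l
  simp only [skewMoment, Matrix.of_apply, hfirst, hsum, Matrix.smul_apply, Matrix.one_apply,
    smul_eq_mul]
  rw [EuclideanSpace.inner_single_left]
  split_ifs with hkl
  · simp [hkl]
    ring
  · simp [hkl]

lemma exists_gram_eq_smul_one (hs : LieAlgebra.IsSimple ℝ μ.Alg) {θ : 𝔤 ≃ₗ⁅ℝ⁆ 𝔤}
    (hθ : IsCartanInvolution θ) {θ' : μ.Alg ≃ₗ⁅ℝ⁆ μ.Alg} (h : IsAdjointInvolution θ')
    {φ : μ.Alg →ₗ⁅ℝ⁆ 𝔤} (hφ : ∀ X, θ (φ X) = φ (θ' X)) :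
    ∃ r : ℝ, gram θ (pairVec μ φ).2 = r • (1 : Matrix (Fin n) (Fin n) ℝ) := by
  have hlie : ∀ Z X Y : μ.Alg, gInner θ (φ ⁅Z, X⁆) (φ Y) = gInner θ (φ X) (φ (-⁅θ' Z, Y⁆)) :=
    fun Z X Y => by
      rw [LieHom.map_lie, gInner_lie, hφ, neg_lie, map_neg, LieHom.map_lie]
  obtain ⟨r, hr⟩ := exists_eq_mul_inner hs ((gForm θ).compl₁₂ (pairVec μ φ).2 (pairVec μ φ).2)
    (fun X Y => gInner_comm θ hθ _ _) (fun Z X Y => by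
      have h1 : LinearMap.adjoint (μ.toSkew.1 Z) = -μ.toSkew.1 (θ' Z) :=
        (neg_eq_iff_eq_neg.2 (h Z)).symm
      rw [h1]
      exact hlie Z X Y)
  refine ⟨r, ?_⟩
  ext k l
  refine (hr (stdVec k) (stdVec l)).trans ?_
  rw [EuclideanSpace.inner_single_left, Matrix.smul_apply, Matrix.one_apply]
  split_ifs with hkl <;> simp [hkl]

lemma uVec_eq_zero {θ : 𝔤 ≃ₗ⁅ℝ⁆ 𝔤} {θ' : μ.Alg ≃ₗ⁅ℝ⁆ μ.Alg}
    (hT : LinearMap.adjoint (toEnd θ') = toEnd θ') {φ : μ.Alg →ₗ⁅ℝ⁆ 𝔤}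
    (hφ : ∀ X, θ (φ X) = φ (θ' X)) : uVec θ (pairVec μ φ).2 = 0 := by
  -- Self-adjointness moves `θ'` to the other argument, and skew symmetry then shows that the sum
  -- equals its own negative.
  have h0 : ∑ i : Fin n, μ.toSkew.1 (toEnd θ' (stdVec i)) (stdVec i) = 0 := by
    refine ext_inner_left ℝ fun W => ?_
    have h1 := sum_apply_adjoint (μ.toSkew.1.compr₂ (innerₗ (Euc n) W)) (toEnd θ')
    simp only [LinearMap.compr₂_apply, innerₗ_apply_apply, hT] at h1
    rw [inner_zero_right, inner_sum]
    have h2 : ∀ i : Fin n, inner ℝ W (μ.toSkew.1 (stdVec i) (toEnd θ' (stdVec i)))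
        = -inner ℝ W (μ.toSkew.1 (toEnd θ' (stdVec i)) (stdVec i)) := fun i => by
      rw [Skew.swap, inner_neg_right]
    simp only [h2, Finset.sum_neg_distrib] at h1
    linarith
  have h3 : ∀ X : μ.Alg, ⁅θ (φ X), φ X⁆ = φ ⁅θ' X, X⁆ := fun X => by rw [hφ, LieHom.map_lie]
  have h4 : uVec θ (pairVec μ φ).2
      = (pairVec μ φ).2 (∑ i : Fin n, μ.toSkew.1 (toEnd θ' (stdVec i)) (stdVec i)) := by
    rw [map_sum]
    exact Finset.sum_congr rfl fun i _ => h3 _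
  rw [h4, h0, map_zero]

end Backward

lemma energy_mk (θ : 𝔤 ≃ₗ⁅ℝ⁆ 𝔤) {v : PairSpace n 𝔤} (hv : v ≠ 0) :
    energy θ (Projectivization.mk ℝ v hv) = momentNormSq θ (momentMap θ v) := rfl

end LiePairs

/-! ### The characterization of energy `1/n` -/

open LiePairs in
theorem mainTheorem7 (n : ℕ) {𝔤 : Type*} [LieRing 𝔤] [LieAlgebra ℝ 𝔤] [FiniteDimensional ℝ 𝔤]
    [LieAlgebra.IsSemisimple ℝ 𝔤] (θ : 𝔤 ≃ₗ⁅ℝ⁆ 𝔤) (hθ : IsCartanInvolution θ)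
    (μ : LieLaw n) (φ : μ.Alg →ₗ⁅ℝ⁆ 𝔤) (hne : pairVec μ φ ≠ 0)
    (hsimple : LieAlgebra.IsSimple ℝ μ.Alg) :
    energy θ (Projectivization.mk ℝ (pairVec μ φ) hne) = 1 / (n : ℝ) ↔
      ∃ θ' : μ.Alg ≃ₗ⁅ℝ⁆ μ.Alg, IsCartanInvolution θ' ∧
        (∀ X : μ.Alg, θ (φ X) = φ (θ' X)) ∧
        ∀ X Y : μ.Alg, inner ℝ X Y =
          -((n : ℝ) / (2 * skewInner μ.toSkew μ.toSkew)) * killingForm ℝ μ.Alg (θ' X) Y := by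
  have hc : ∀ (θ' : μ.Alg ≃ₗ⁅ℝ⁆ μ.Alg) (X Y : Euc n),
      -((n : ℝ) / (2 * skewInner μ.toSkew μ.toSkew)) * killingForm ℝ μ.Alg (θ' X) Y
        = (n : ℝ) / (2 * skewInner μ.toSkew μ.toSkew) * gInner (𝔤 := μ.Alg) θ' X Y :=
    fun θ' X Y => neg_mul_comm _ _
  have hn : (n : ℝ) ≠ 0 := by
    have := LieLaw.nontrivial hsimple
    rintro h0
    obtain rfl : n = 0 := by exact_mod_cast h0
    exact not_subsingleton (Euc 0) inferInstance
  rw [energy_mk, momentNormSq_momentMap_eq_iff hθ hne hn]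
  constructor
  · rintro ⟨h1, h2⟩
    have hst : ∀ X : μ.Alg,
        pairAct (LinearMap.adjoint (μ.toSkew.1 X)) (-θ (φ X)) (pairVec μ φ) = 0 := fun X =>
      pairAct_adjoint_eq_zero hθ hne h1 h2 (pairAct_pairVec φ X)
    obtain ⟨θ', h'⟩ := exists_isAdjointInvolution hsimple fun X => by
      obtain ⟨W, hW⟩ := exists_inner_of_pairAct_eq_zero hsimple (hst X)
      exact ⟨-W, by rw [map_neg, hW]⟩
    have hθ' := h'.isCartanInvolution hsimple
    refine ⟨θ', hθ', apply_comm_of_lie_eq hsimple hθ hθ'.involutive fun X Y => ?_, fun X Y =>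
      (h'.inner_eq hsimple X Y).trans (hc θ' X Y).symm⟩
    -- The `𝔤`-component of the transposed annihilation: `[θ φ X, φ Y] = -φ((ad X)ᵀ Y) = φ [θ' X,
    -- Y]`.
    have h3 : ⁅-θ (φ X), φ Y⁆ - (pairVec μ φ).2 (LinearMap.adjoint (μ.toSkew.1 X) Y) = 0 :=
      congrArg (fun w : PairSpace n 𝔤 => w.2 Y) (hst X)
    have h4 : ∀ X Y : Euc n, (pairVec μ φ).2 (μ.toSkew.1 (θ' X) Y)
        = -(pairVec μ φ).2 (LinearMap.adjoint (μ.toSkew.1 X) Y) := fun X Y => by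
      rw [show μ.toSkew.1 (θ' X) = -LinearMap.adjoint (μ.toSkew.1 X) from h' X,
        LinearMap.neg_apply, map_neg]
    rw [neg_lie, sub_eq_zero] at h3
    exact (neg_eq_iff_eq_neg.1 h3).trans (h4 X Y).symm
  · rintro ⟨θ', hθ', hφ, hin⟩
    have h : ∀ X Y : Euc n, inner ℝ X Y
        = (n : ℝ) / (2 * skewInner μ.toSkew μ.toSkew) * gInner (𝔤 := μ.Alg) θ' X Y :=
      fun X Y => (hin X Y).trans (hc θ' X Y)
    have h' := isAdjointInvolution_of_inner_eq h
    have hT := adjoint_toEnd hθ' h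
    obtain ⟨r, hr⟩ := h'.exists_gInner_eq hsimple
    obtain ⟨s, hs⟩ := exists_gram_eq_smul_one hsimple hθ h' hφ
    have h1 : (momentMap θ (pairVec μ φ)).1
        = ((pairInner θ (pairVec μ φ) (pairVec μ φ))⁻¹ * (-(r / 2) - s)) •
          (1 : Matrix (Fin n) (Fin n) ℝ) := by
      rw [momentMap, Prod.smul_fst, hs, show (pairVec μ φ).1 = μ.toSkew from rfl,
        skewMoment_eq_smul_one hθ' h' hT hr, ← sub_smul, smul_smul]
    refine ⟨?_, by rw [momentMap, Prod.smul_snd, uVec_eq_zero hT hφ, smul_zero]⟩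
    -- The trace `-1` forces the scalar to be `-1/n`, so `r` and `s` need not be computed.
    have htr := trace_momentMap hθ hne
    rw [h1, Matrix.trace_smul, Matrix.trace_one, Fintype.card_fin, smul_eq_mul] at htr
    rw [h1]
    congr 1
    rw [show -(1 / (n : ℝ)) = -1 / n from (neg_div _ _).symm, eq_div_iff hn]
    exact htr
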